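/- Let $E$ be a Dedekind complete (real) Riesz space with weak order unit $e$, and let $T$ be a conditional expectation operator on $E$, that is, a strictly positive order continuous linear projection with $Te=e$ and Dedekind complete range. Let $S$ be an order continuous Riesz homomorphism on $E$ with $Se=e$ and $TSf=Tf$ for all $f\in E$; the tuple $(E,T,S,e)$ is then called a conditional expectation preserving system. Let $E^u$ be the universal completion of $E$, that is, the universally complete (Dedekind complete and laterally complete) Riesz space, unique up to isomorphism, that contains $E$ as an order dense Riesz subspace. Put $$D=\{x\in E^u_+ : \text{there is a net } (x_\alpha)\subset E_+ \text{ with } 0\le x_\alpha\uparrow x \text{ and } (Tx_\alpha) \text{ order bounded in } E^u\},\qquad L^1(T)=D-D .$$ Then $L^1(T)$ is a Riesz subspace of $E^u$ that contains $E$, and $T$ extends to $L^1(T)$ by $Tx=\sup_\alpha Tx_\alpha$ for $x\in D$ and $x_\alpha$ as above, and $Tf=Tf^+-Tf^-$ for $f\in L^1(T)$. **Theorem.** Let $(E,T,S,e)$ be a conditional expectation preserving system. Then $S$ has a unique extension to an order continuous Riesz homomorphism $S: L^1(T)\to L^1(T)$, and this extension satisfies $TSf=Tf$ for all $f\in L^1(T)$.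 -/

import Mathlib

set_option linter.unusedSectionVars false

/-- Order continuity of a *positive* linear operator between Riesz spaces: `x_α ↓ 0` implies
`f x_α ↓ 0`. A decreasing net is given by its range, a nonempty downward directed set. -/
def IsOrderContinuous {E F : Type*} [AddCommGroup E] [Module ℝ E] [Lattice E]
    [AddCommGroup F] [Module ℝ F] [Lattice F] (f : E →ₗ[ℝ] F) : Prop :=
  ∀ A : Set E, A.Nonempty → DirectedOn (· ≥ ·) A → IsGLB A 0 → IsGLB (f '' A) 0

/-- A Riesz (lattice) homomorphism: a linear map with `f (x ∨ y) = f x ∨ f y`. -/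
def IsRieszHom {E F : Type*} [AddCommGroup E] [Module ℝ E] [Lattice E]
    [AddCommGroup F] [Module ℝ F] [Lattice F] (f : E →ₗ[ℝ] F) : Prop :=
  ∀ x y : E, f (x ⊔ y) = f x ⊔ f y

/-- A conditional Riesz triple `(E, e, T)`: `E` is a Dedekind complete Riesz space, `e` is a weak
order unit of `E`, and `T` is a conditional expectation operator on `E`, that is, a strictly
positive order continuous linear projection with `T e = e` and Dedekind complete range. -/
structure ConditionalRieszTriple (E : Type*) [AddCommGroup E] [ConditionallyCompleteLattice E]
    [IsOrderedAddMonoid E] [Module ℝ E] [IsOrderedModule ℝ E] where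
  e : E
  T : E →ₗ[ℝ] E
  e_nonneg : 0 ≤ e
  e_unit : ∀ x : E, 0 ≤ x → x ⊓ e = 0 → x = 0
  T_nonneg : ∀ x : E, 0 ≤ x → 0 ≤ T x
  T_strict : ∀ x : E, 0 ≤ x → T x = 0 → x = 0
  T_orderContinuous : IsOrderContinuous T
  T_proj : ∀ x : E, T (T x) = T x
  T_e : T e = e
  T_range : ∀ A : Set (LinearMap.range T), A.Nonempty → BddAbove A → ∃ x, IsLUB A x

/-- A conditional expectation preserving system `(E, T, S, e)`: a conditional Riesz triple with an
order continuous Riesz homomorphism `S` on `E` such that `S e = e` and `T S = T`. -/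
structure CondExpPreservingSystem (E : Type*) [AddCommGroup E] [ConditionallyCompleteLattice E]
    [IsOrderedAddMonoid E] [Module ℝ E] [IsOrderedModule ℝ E]
    extends ConditionalRieszTriple E where
  S : E →ₗ[ℝ] E
  S_rieszHom : IsRieszHom S
  S_orderContinuous : IsOrderContinuous S
  S_e : S e = e
  T_S : ∀ f : E, T (S f) = T f

/-- `U` is a universal completion of `E`: a universally complete (Dedekind complete and laterally
complete) Riesz space in which `E` is embedded, through `ι`, as an order dense Riesz subspace.
It is unique up to a Riesz isomorphism that fixes `E`. -/
structure UniversalCompletion (E U : Type*) [AddCommGroup E] [Lattice E] [Module ℝ E]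
    [AddCommGroup U] [ConditionallyCompleteLattice U] [IsOrderedAddMonoid U]
    [Module ℝ U] [IsOrderedModule ℝ U] where
  ι : E →ₗ[ℝ] U
  ι_injective : Function.Injective ι
  ι_rieszHom : IsRieszHom ι
  /-- `E` is order dense in `U`. -/
  orderDense : ∀ u : U, 0 < u → ∃ x : E, 0 < x ∧ ι x ≤ u
  /-- Every nonempty set of pairwise disjoint positive elements of `U` has a supremum. -/
  laterallyComplete : ∀ A : Set U, A.Nonempty → (∀ u ∈ A, 0 ≤ u) →
    A.Pairwise (fun u v => u ⊓ v = 0) → ∃ w, IsLUB A w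

namespace CondExp

section Aux

variable {E F : Type*} [AddCommGroup E] [Lattice E] [IsOrderedAddMonoid E] [Module ℝ E]
  [AddCommGroup F] [Lattice F] [IsOrderedAddMonoid F] [Module ℝ F]

lemma isLUB_inf {A : Set E} {x : E} (h : IsLUB A x) (z : E) :
    IsLUB ((fun a => z ⊓ a) '' A) (z ⊓ x) := by
  constructor
  · rintro _ ⟨a, ha, rfl⟩
    exact inf_le_inf_left z (h.1 ha)
  · intro v hv
    have key : x ≤ v + z ⊔ x - z := by
      apply h.2
      intro a ha
      have h1 : z ⊓ a ≤ v := hv ⟨a, ha, rfl⟩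
      have h2 : z ⊔ a ≤ z ⊔ x := sup_le_sup_left (h.1 ha) z
      have h3 : z ⊓ a + z ⊔ a = z + a := inf_add_sup z a
      have h4 : z + a ≤ v + z ⊔ x := h3 ▸ add_le_add h1 h2
      rw [le_sub_iff_add_le, add_comm]
      exact h4
    have h3 : z ⊓ x + z ⊔ x = z + x := inf_add_sup z x
    rw [le_sub_iff_add_le, add_comm, ← h3] at key
    exact le_of_add_le_add_right key

lemma isLUB_add {A B : Set E} {x y : E} (hA : IsLUB A x) (hB : IsLUB B y) :
    IsLUB (Set.image2 (· + ·) A B) (x + y) := by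
  constructor
  · rintro _ ⟨a, ha, b, hb, rfl⟩
    exact add_le_add (hA.1 ha) (hB.1 hb)
  · intro v hv
    have h1 : x ≤ v - y := by
      apply hA.2
      intro a ha
      have : y ≤ v - a := by
        apply hB.2
        intro b hb
        rw [le_sub_iff_add_le, add_comm]
        exact hv ⟨a, ha, b, hb, rfl⟩
      rw [le_sub_iff_add_le] at this ⊢
      rwa [add_comm]
    exact le_sub_iff_add_le.1 h1

lemma isLUB_image {f : E →ₗ[ℝ] F} (hf : IsOrderContinuous f) {A : Set E} {x : E}
    (hne : A.Nonempty) (hd : DirectedOn (· ≤ ·) A) (h : IsLUB A x) :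
    IsLUB (f '' A) (f x) := by
  have hg : IsGLB ((fun a => x - a) '' A) 0 := by
    constructor
    · rintro _ ⟨a, ha, rfl⟩
      exact sub_nonneg.2 (h.1 ha)
    · intro v hv
      have : x ≤ x - v := by
        apply h.2
        intro a ha
        have : v ≤ x - a := hv ⟨a, ha, rfl⟩
        rw [le_sub_comm]
        exact this
      simpa using this
  have hdd : DirectedOn (· ≥ ·) ((fun a => x - a) '' A) := by
    rintro _ ⟨a, ha, rfl⟩ _ ⟨b, hb, rfl⟩
    obtain ⟨c, hc, hac, hbc⟩ := hd a ha b hb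
    exact ⟨x - c, ⟨c, hc, rfl⟩, sub_le_sub_left hac x, sub_le_sub_left hbc x⟩
  have := hf _ (hne.image _) hdd hg
  constructor
  · rintro _ ⟨a, ha, rfl⟩
    have h0 : 0 ≤ f (x - a) := this.1 ⟨x - a, ⟨a, ha, rfl⟩, rfl⟩
    rw [map_sub] at h0
    exact sub_nonneg.1 h0
  · intro v hv
    have : f x - v ≤ 0 := by
      apply this.2
      rintro _ ⟨_, ⟨a, ha, rfl⟩, rfl⟩
      have hav : f a ≤ v := hv ⟨a, ha, rfl⟩
      simp only [map_sub]
      exact sub_le_sub_left hav _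
    exact sub_nonpos.1 this

end Aux

variable {E U : Type*} [AddCommGroup E] [ConditionallyCompleteLattice E]
  [IsOrderedAddMonoid E] [Module ℝ E] [IsOrderedModule ℝ E]
  [AddCommGroup U] [ConditionallyCompleteLattice U] [IsOrderedAddMonoid U]
  [Module ℝ U] [IsOrderedModule ℝ U]
  (C : ConditionalRieszTriple E) (K : UniversalCompletion E U)

/-- The set `D` of those `x` in the positive cone of the universal completion for which there is a
net `0 ≤ x_α ↑ x` in `E` such that `(T x_α)` is order bounded in the universal completion. An
increasing net is given by its range, a nonempty upward directed set. -/
def L1Cone : Set U :=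
  {x | ∃ A : Set E, A.Nonempty ∧ DirectedOn (· ≤ ·) A ∧ (∀ a ∈ A, 0 ≤ a) ∧
    IsLUB (K.ι '' A) x ∧ BddAbove ((fun a => K.ι (C.T a)) '' A)}

/-- The elements of `E` that lie between `0` and `x`. -/
def minorants (x : U) : Set E := {z | 0 ≤ z ∧ K.ι z ≤ x}

variable {C K}

lemma ι_le_iff {x y : E} : K.ι x ≤ K.ι y ↔ x ≤ y := by
  rw [← sup_eq_right, ← K.ι_rieszHom, K.ι_injective.eq_iff, sup_eq_right]

lemma ι_nonneg {x : E} (h : 0 ≤ x) : 0 ≤ K.ι x := by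
  have := (ι_le_iff (K := K)).2 h
  rwa [map_zero] at this

lemma T_mono {x y : E} (h : x ≤ y) : C.T x ≤ C.T y := by
  have := C.T_nonneg (y - x) (sub_nonneg.2 h)
  rw [map_sub] at this
  exact sub_nonneg.1 this

/-- The embedding into the universal completion preserves suprema. -/
lemma isLUB_ι {A : Set E} {x : E} (h : IsLUB A x) : IsLUB (K.ι '' A) (K.ι x) := by
  constructor
  · rintro _ ⟨a, ha, rfl⟩
    exact ι_le_iff.2 (h.1 ha)
  · intro v hv
    by_contra hlt
    have hne : 0 < K.ι x - v ⊓ K.ι x := by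
      rw [sub_pos]
      exact lt_of_le_of_ne inf_le_right (fun hh => hlt (inf_eq_right.1 hh))
    obtain ⟨y, hy, hyle⟩ := K.orderDense _ hne
    have : x ≤ x - y := by
      apply h.2
      intro a ha
      have h1 : K.ι a ≤ v ⊓ K.ι x := le_inf (hv ⟨a, ha, rfl⟩) (ι_le_iff.2 (h.1 ha))
      have h2 : K.ι a ≤ K.ι x - K.ι y := h1.trans (le_sub_comm.1 hyle)
      rw [← map_sub] at h2
      exact ι_le_iff.1 h2
    have h0 : y ≤ 0 := by simpa using this
    exact absurd hy (not_lt_of_ge h0)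

lemma zero_mem_minorants {x : U} (hx : 0 ≤ x) : (0 : E) ∈ minorants K x :=
  ⟨le_rfl, by rwa [map_zero]⟩

lemma directed_minorants (x : U) : DirectedOn (· ≤ ·) (minorants K x) := by
  rintro a ⟨ha0, hax⟩ b ⟨hb0, hbx⟩
  refine ⟨a ⊔ b, ⟨ha0.trans le_sup_left, ?_⟩, le_sup_left, le_sup_right⟩
  rw [K.ι_rieszHom]
  exact sup_le hax hbx

lemma isLUB_minorants {x : U} (hx : 0 ≤ x) : IsLUB (K.ι '' minorants K x) x := by
  have hbd : BddAbove (K.ι '' minorants K x) := ⟨x, by rintro _ ⟨z, hz, rfl⟩; exact hz.2⟩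
  have hl := isLUB_csSup (Set.Nonempty.image K.ι ⟨0, zero_mem_minorants hx⟩) hbd
  set s := sSup (K.ι '' minorants K x)
  have hsx : s ≤ x := hl.2 (by rintro _ ⟨z, hz, rfl⟩; exact hz.2)
  rcases hsx.eq_or_lt with h | h
  · rwa [h] at hl
  exfalso
  obtain ⟨y, hy, hyle⟩ := K.orderDense _ (sub_pos.2 h)
  have hss : s ≤ s - K.ι y := by
    apply hl.2
    rintro _ ⟨z, hz, rfl⟩
    rw [le_sub_iff_add_le, ← map_add]
    have hzs : K.ι z ≤ s := hl.1 ⟨z, hz, rfl⟩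
    refine hl.1 ⟨z + y, ⟨add_nonneg hz.1 hy.le, ?_⟩, rfl⟩
    rw [map_add]
    calc K.ι z + K.ι y ≤ s + (x - s) := add_le_add hzs hyle
      _ = x := by abel
  have h0 : K.ι y ≤ K.ι 0 := by
    rw [map_zero]
    simpa using hss
  exact absurd hy (not_lt_of_ge (ι_le_iff.1 h0))

lemma ι_T_le {A : Set E} {x w : U} (hne : A.Nonempty) (hd : DirectedOn (· ≤ ·) A)
    (hx : IsLUB (K.ι '' A) x) (hw : w ∈ upperBounds ((fun a => K.ι (C.T a)) '' A))
    {z : E} (hz : K.ι z ≤ x) : K.ι (C.T z) ≤ w := by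
  have h1 := isLUB_inf hx (K.ι z)
  rw [inf_eq_left.2 hz] at h1
  have h2 : IsLUB ((fun a => z ⊓ a) '' A) z := by
    constructor
    · rintro _ ⟨a, -, rfl⟩
      exact inf_le_left
    · intro v hv
      rw [← ι_le_iff (K := K)]
      apply h1.2
      rintro _ ⟨_, ⟨a, ha, rfl⟩, rfl⟩
      have h3 : z ⊓ a ≤ v := hv ⟨a, ha, rfl⟩
      have h4 : K.ι (z ⊓ a) = K.ι z ⊓ K.ι a := by
        have e1 : z ⊓ a = z + a - z ⊔ a := eq_sub_of_add_eq (inf_add_sup z a)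
        have e2 : K.ι z ⊓ K.ι a = K.ι z + K.ι a - K.ι z ⊔ K.ι a :=
          eq_sub_of_add_eq (inf_add_sup _ _)
        rw [e1, e2, map_sub, map_add, K.ι_rieszHom]
      show K.ι z ⊓ K.ι a ≤ K.ι v
      rw [← h4]
      exact ι_le_iff.2 h3
  have hdd : DirectedOn (· ≤ ·) ((fun a => z ⊓ a) '' A) := by
    rintro _ ⟨a, ha, rfl⟩ _ ⟨b, hb, rfl⟩
    obtain ⟨c, hc, hac, hbc⟩ := hd a ha b hb
    exact ⟨z ⊓ c, ⟨c, hc, rfl⟩, inf_le_inf_left z hac, inf_le_inf_left z hbc⟩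
  have h5 := isLUB_ι (K := K) (isLUB_image C.T_orderContinuous (hne.image _) hdd h2)
  apply h5.2
  rintro _ ⟨_, ⟨_, ⟨a, ha, rfl⟩, rfl⟩, rfl⟩
  exact (ι_le_iff.2 (T_mono inf_le_right)).trans (hw ⟨a, ha, rfl⟩)

lemma L1Cone_nonneg {x : U} (hx : x ∈ L1Cone C K) : 0 ≤ x := by
  obtain ⟨A, ⟨a, ha⟩, -, h0, hl, -⟩ := hx
  exact (ι_nonneg (h0 a ha)).trans (hl.1 ⟨a, ha, rfl⟩)

lemma bddAbove_minorants {x : U} (hx : x ∈ L1Cone C K) :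
    BddAbove ((fun z => K.ι (C.T z)) '' minorants K x) := by
  obtain ⟨A, hne, hd, -, hl, w, hw⟩ := hx
  refine ⟨w, ?_⟩
  rintro _ ⟨z, hz, rfl⟩
  exact ι_T_le hne hd hl hw hz.2

lemma L1Cone_solid {x y : U} (hx : x ∈ L1Cone C K) (hy : 0 ≤ y) (hyx : y ≤ x) :
    y ∈ L1Cone C K := by
  refine ⟨minorants K y, ⟨0, zero_mem_minorants hy⟩, directed_minorants y, fun a ha => ha.1,
    isLUB_minorants hy, (bddAbove_minorants hx).mono ?_⟩
  exact Set.image_mono fun z hz => ⟨hz.1, hz.2.trans hyx⟩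

lemma L1Cone_ι {z : E} (hz : 0 ≤ z) : K.ι z ∈ L1Cone C K := by
  refine ⟨{z}, Set.singleton_nonempty z, ?_, by simpa using hz, by simp, by simp⟩
  rintro a rfl b rfl
  exact ⟨_, rfl, le_rfl, le_rfl⟩

lemma L1Cone_add {x y : U} (hx : x ∈ L1Cone C K) (hy : y ∈ L1Cone C K) :
    x + y ∈ L1Cone C K := by
  obtain ⟨A, hne, hd, h0, hl, w, hw⟩ := hx
  obtain ⟨B, hne', hd', h0', hl', w', hw'⟩ := hy
  refine ⟨Set.image2 (· + ·) A B, hne.image2 hne', ?_, ?_, ?_, w + w', ?_⟩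
  · rintro _ ⟨a, ha, b, hb, rfl⟩ _ ⟨a', ha', b', hb', rfl⟩
    obtain ⟨c, hc, h1, h2⟩ := hd a ha a' ha'
    obtain ⟨d, hdB, h3, h4⟩ := hd' b hb b' hb'
    exact ⟨c + d, ⟨c, hc, d, hdB, rfl⟩, add_le_add h1 h3, add_le_add h2 h4⟩
  · rintro _ ⟨a, ha, b, hb, rfl⟩
    exact add_nonneg (h0 a ha) (h0' b hb)
  · have := isLUB_add hl hl'
    rwa [← Set.image_image2_distrib (g := K.ι) (f := (· + ·)) (fun a b => map_add K.ι a b)]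
      at this
  · rintro _ ⟨_, ⟨a, ha, b, hb, rfl⟩, rfl⟩
    simp only [map_add]
    exact add_le_add (hw ⟨a, ha, rfl⟩) (hw' ⟨b, hb, rfl⟩)

lemma L1Cone_smul {x : U} (hx : x ∈ L1Cone C K) {c : ℝ} (hc : 0 ≤ c) :
    c • x ∈ L1Cone C K := by
  obtain ⟨n, hn⟩ := exists_nat_ge c
  have hx0 := L1Cone_nonneg hx
  have hnx : ∀ n : ℕ, (n : ℝ) • x ∈ L1Cone C K := by
    intro n
    induction n with
    | zero => simpa using L1Cone_ι (C := C) (K := K) (le_refl (0 : E))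
    | succ k ih =>
      rw [Nat.cast_succ, add_smul, one_smul]
      exact L1Cone_add ih hx
  exact L1Cone_solid (hnx n) (smul_nonneg hc hx0) (smul_le_smul_of_nonneg_right hn hx0)

variable (C K)

/-- The natural domain `L¹(T) = D - D` of the conditional expectation `T`. -/
def L1 : Submodule ℝ U where
  carrier := {f | ∃ x ∈ L1Cone C K, ∃ y ∈ L1Cone C K, f = x - y}
  zero_mem' := by
    have h0 : (0 : U) ∈ L1Cone C K := by
      simpa using L1Cone_ι (C := C) (K := K) (le_refl (0 : E))
    exact ⟨0, h0, 0, h0, by simp⟩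
  add_mem' := by
    rintro _ _ ⟨x, hx, y, hy, rfl⟩ ⟨x', hx', y', hy', rfl⟩
    exact ⟨x + x', L1Cone_add hx hx', y + y', L1Cone_add hy hy', by abel⟩
  smul_mem' := by
    rintro c _ ⟨x, hx, y, hy, rfl⟩
    rcases le_total 0 c with hc | hc
    · exact ⟨c • x, L1Cone_smul hx hc, c • y, L1Cone_smul hy hc, smul_sub c x y⟩
    · have hc' : 0 ≤ -c := neg_nonneg.2 hc
      refine ⟨(-c) • y, L1Cone_smul hy hc', (-c) • x, L1Cone_smul hx hc', ?_⟩
      rw [smul_sub, neg_smul, neg_smul]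
      abel

variable {C K}

lemma L1Cone_sup_zero {f : U} (hf : f ∈ L1 C K) : f ⊔ 0 ∈ L1Cone C K := by
  obtain ⟨x, hx, y, hy, rfl⟩ := hf
  exact L1Cone_solid hx le_sup_right
    (sup_le (sub_le_self x (L1Cone_nonneg hy)) (L1Cone_nonneg hx))

lemma L1_of_cone {x : U} (hx : x ∈ L1Cone C K) : x ∈ L1 C K :=
  ⟨x, hx, 0, by simpa using L1Cone_ι (C := C) (K := K) (le_refl (0 : E)), by simp⟩

lemma L1_sup {f g : U} (hf : f ∈ L1 C K) (hg : g ∈ L1 C K) : f ⊔ g ∈ L1 C K := by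
  have h : f ⊔ g = (f - g) ⊔ 0 + g := by rw [sup_add]; simp
  rw [h]
  exact (L1 C K).add_mem (L1_of_cone (L1Cone_sup_zero ((L1 C K).sub_mem hf hg))) hg

lemma L1_inf {f g : U} (hf : f ∈ L1 C K) (hg : g ∈ L1 C K) : f ⊓ g ∈ L1 C K := by
  have h : f ⊓ g = f + g - f ⊔ g := eq_sub_of_add_eq (inf_add_sup f g)
  rw [h]
  exact (L1 C K).sub_mem ((L1 C K).add_mem hf hg) (L1_sup hf hg)

/-- `L¹(T)` is a Riesz subspace of the universal completion, with the inherited order. -/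
instance : Lattice (L1 C K) :=
  Subtype.lattice (fun _ _ hf hg => L1_sup hf hg) (fun _ _ hf hg => L1_inf hf hg)

lemma L1_ι (z : E) : K.ι z ∈ L1 C K := by
  have h : K.ι z = K.ι (z ⊔ 0) - K.ι (z ⊔ 0 - z) := by rw [map_sub]; abel
  exact ⟨_, L1Cone_ι le_sup_right, _, L1Cone_ι (sub_nonneg.2 le_sup_left), h⟩

variable (C K)

/-- The inclusion of `E` into `L¹(T)`. -/
def toL1 : E →ₗ[ℝ] L1 C K := K.ι.codRestrict (L1 C K) L1_ι

/-- The value `sup {T z : z ∈ E, 0 ≤ z ≤ x}` of the extension of `T` at an element `x` of the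
cone `D`; it is `sup T x_α` for every net `0 ≤ x_α ↑ x` in `E`, see `isLUB_condExpCone`. -/
noncomputable def condExpCone (x : U) : U := sSup ((fun z => K.ι (C.T z)) '' minorants K x)

variable {C K}

lemma isLUB_condExpCone {x : U} (hx : x ∈ L1Cone C K) {A : Set E} (hne : A.Nonempty)
    (hd : DirectedOn (· ≤ ·) A) (h0 : ∀ a ∈ A, 0 ≤ a) (hA : IsLUB (K.ι '' A) x) :
    IsLUB ((fun a => K.ι (C.T a)) '' A) (condExpCone C K x) := by
  have hl : IsLUB ((fun z => K.ι (C.T z)) '' minorants K x) (condExpCone C K x) :=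
    isLUB_csSup ⟨_, ⟨0, zero_mem_minorants (L1Cone_nonneg hx), rfl⟩⟩ (bddAbove_minorants hx)
  constructor
  · rintro _ ⟨a, ha, rfl⟩
    exact hl.1 ⟨a, ⟨h0 a ha, hA.1 ⟨a, ha, rfl⟩⟩, rfl⟩
  · intro w hw
    apply hl.2
    rintro _ ⟨z, hz, rfl⟩
    exact ι_T_le hne hd hA hw hz.2

lemma condExpCone_mem {x : U} (hx : x ∈ L1Cone C K) : condExpCone C K x ∈ L1 C K := by
  have hx0 := L1Cone_nonneg hx
  have hl := isLUB_condExpCone hx ⟨0, zero_mem_minorants hx0⟩ (directed_minorants x)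
    (fun a ha => ha.1) (isLUB_minorants hx0)
  refine L1_of_cone ⟨C.T '' minorants K x, ⟨_, ⟨0, zero_mem_minorants hx0, rfl⟩⟩, ?_, ?_, ?_, ?_⟩
  · rintro _ ⟨a, ha, rfl⟩ _ ⟨b, hb, rfl⟩
    obtain ⟨c, hc, h1, h2⟩ := directed_minorants x a ha b hb
    exact ⟨C.T c, ⟨c, hc, rfl⟩, T_mono h1, T_mono h2⟩
  · rintro _ ⟨a, ha, rfl⟩
    exact C.T_nonneg a ha.1
  · rwa [Set.image_image]
  · rw [Set.image_image]
    simp only [C.T_proj]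
    exact bddAbove_minorants hx

variable (C K)

/-- The extension of the conditional expectation `T` to its natural domain `L¹(T)`:
`T f = T f⁺ - T f⁻`, with `T x = sup T x_α` for `x` in the cone `D` and `0 ≤ x_α ↑ x` in `E`. -/
noncomputable def condExp (f : L1 C K) : L1 C K :=
  ⟨condExpCone C K (f : U)⁺ - condExpCone C K (f : U)⁻,
    (L1 C K).sub_mem (condExpCone_mem (L1Cone_sup_zero f.2))
      (condExpCone_mem (L1Cone_sup_zero ((L1 C K).neg_mem f.2)))⟩

end CondExp

namespace CondExp

section LatticeGroup

variable {G : Type*} [AddCommGroup G] [Lattice G] [IsOrderedAddMonoid G]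

lemma add_inf_eq_zero {a b r : G} (ha : 0 ≤ a) (hb : 0 ≤ b) (hr : 0 ≤ r)
    (har : a ⊓ r = 0) (hbr : b ⊓ r = 0) : (a + b) ⊓ r = 0 := by
  apply le_antisymm _ (le_inf (add_nonneg ha hb) hr)
  have h1 : (a + b) ⊓ r - a ≤ b ⊓ r :=
    le_inf (by rw [sub_le_iff_le_add']; exact inf_le_left)
      ((sub_le_self _ ha).trans inf_le_right)
  rw [hbr, sub_nonpos] at h1
  exact har ▸ le_inf h1 inf_le_right

lemma inf_nsmul_eq_zero {a r : G} (ha : 0 ≤ a) (hr : 0 ≤ r) (h : a ⊓ r = 0) (n : ℕ) :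
    a ⊓ n • r = 0 := by
  induction n with
  | zero => simpa using ha
  | succ k ih =>
    rw [succ_nsmul, inf_comm]
    exact add_inf_eq_zero (nsmul_nonneg hr k) hr ha (by rwa [inf_comm]) (by rwa [inf_comm])

lemma inf_eq_zero_of_le {a r s : G} (ha : 0 ≤ a) (hr : 0 ≤ r) (hrs : r ≤ s) (h : a ⊓ s = 0) :
    a ⊓ r = 0 :=
  le_antisymm (h ▸ inf_le_inf_left a hrs) (le_inf ha hr)

lemma sub_sup_zero_eq (a b : G) : (a - b) ⊔ 0 = a - a ⊓ b := by
  rw [sub_inf]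
  simp [sup_comm]

lemma sub_sup_zero_of_inf_eq_zero {a b : G} (h : a ⊓ b = 0) : (a - b) ⊔ 0 = a := by
  rw [sub_sup_zero_eq, h, sub_zero]

lemma inf_sub_sup_zero_eq_zero {x b s r : G} (hr : r = x - x ⊓ s) (hb : x ⊓ b ≤ s) :
    ((b - x) ⊔ 0) ⊓ r = 0 := by
  have hr0 : 0 ≤ r := by rw [hr, sub_nonneg]; exact inf_le_left
  apply le_antisymm _ (le_inf le_sup_right hr0)
  have h1 : r ≤ x - x ⊓ b := by
    rw [hr]; exact sub_le_sub_left (le_inf inf_le_left hb) x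
  calc ((b - x) ⊔ 0) ⊓ r ≤ (b - x ⊓ b) ⊓ (x - x ⊓ b) := by
        rw [sub_sup_zero_eq, inf_comm b x]; exact inf_le_inf_left _ h1
    _ = 0 := by
        have h2 : (b - x ⊓ b) ⊓ (x - x ⊓ b) = b ⊓ x - x ⊓ b := by
          rw [sub_eq_add_neg, sub_eq_add_neg, ← inf_add, ← sub_eq_add_neg]
        rw [h2, inf_comm, sub_self]
    _ ≤ 0 := le_rfl

end LatticeGroup

section BandProjection

variable {G : Type*} [AddCommGroup G] [ConditionallyCompleteLattice G] [IsOrderedAddMonoid G]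

lemma nonpos_of_forall_nsmul_le {t w : G} (h : ∀ n : ℕ, n • t ≤ w) : t ≤ 0 := by
  have hl : IsLUB (Set.range fun n : ℕ => n • t) (sSup (Set.range fun n : ℕ => n • t)) :=
    isLUB_csSup (Set.range_nonempty _) ⟨w, by rintro _ ⟨n, rfl⟩; exact h n⟩
  set s := sSup (Set.range fun n : ℕ => n • t)
  have : s ≤ s - t := by
    apply hl.2
    rintro _ ⟨n, rfl⟩
    rw [le_sub_iff_add_le]
    show n • t + t ≤ s
    rw [← succ_nsmul]
    exact hl.1 ⟨n + 1, rfl⟩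
  simpa using this

/-- The projection `sup (x ∧ k r)` of `x` to the band generated by `r`. -/
lemma exists_bandProjection {x r : G} (hr : 0 ≤ r) (hrx : r ≤ x) :
    ∃ v, r ≤ v ∧ v ≤ x ∧ (x - v) ⊓ r = 0 ∧ ∀ y, 0 ≤ y → y ⊓ r = 0 → y ⊓ v = 0 := by
  have hl : IsLUB (Set.range fun k : ℕ => x ⊓ k • r) (sSup (Set.range fun k : ℕ => x ⊓ k • r)) :=
    isLUB_csSup (Set.range_nonempty _) ⟨x, by rintro _ ⟨n, rfl⟩; exact inf_le_left⟩
  set v := sSup (Set.range fun k : ℕ => x ⊓ k • r)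
  have hrv : r ≤ v := hl.1 ⟨1, by simpa using hrx⟩
  have hvx : v ≤ x := hl.2 (by rintro _ ⟨n, rfl⟩; exact inf_le_left)
  refine ⟨v, hrv, hvx, ?_, ?_⟩
  · apply le_antisymm _ (le_inf (sub_nonneg.2 hvx) hr)
    have : v ≤ v - (x - v) ⊓ r := by
      apply hl.2
      rintro _ ⟨k, rfl⟩
      have hk : x ⊓ k • r ≤ v := hl.1 ⟨k, rfl⟩
      rw [le_sub_iff_add_le]
      refine le_trans ?_ (hl.1 ⟨k + 1, rfl⟩)
      refine le_inf ?_ ?_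
      · calc _ ≤ v + (x - v) := add_le_add hk inf_le_left
          _ = x := by abel
      · rw [succ_nsmul]
        exact add_le_add inf_le_right inf_le_right
    simpa using this
  · intro y hy h
    have hyv := le_inf hy (hr.trans hrv)
    apply le_antisymm _ hyv
    have hd : DirectedOn (· ≤ ·) (Set.range fun k : ℕ => x ⊓ k • r) := by
      rintro _ ⟨k, rfl⟩ _ ⟨l, rfl⟩
      exact ⟨_, ⟨max k l, rfl⟩, inf_le_inf_left _ (nsmul_le_nsmul_left hr (le_max_left _ _)),
        inf_le_inf_left _ (nsmul_le_nsmul_left hr (le_max_right _ _))⟩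
    have key : v ≤ v + y - y ⊓ v - y := by
      apply hl.2
      rintro _ ⟨k, rfl⟩
      have h0 : y ⊓ (x ⊓ k • r) = 0 :=
        inf_eq_zero_of_le hy (le_inf (hr.trans hrx) (nsmul_nonneg hr k)) inf_le_right
          (inf_nsmul_eq_zero hy hr h k)
      have h1 : y ⊓ (x ⊓ k • r) + y ⊔ (x ⊓ k • r) = y + (x ⊓ k • r) := inf_add_sup _ _
      rw [h0, zero_add] at h1
      have h2 : y ⊓ v + y ⊔ v = y + v := inf_add_sup y v
      have h3 : y ⊔ (x ⊓ k • r) ≤ y ⊔ v := sup_le_sup_left (hl.1 ⟨k, rfl⟩) y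
      rw [h1, eq_sub_of_add_eq' h2] at h3
      rw [le_sub_iff_add_le, add_comm, add_comm v y]
      exact h3
    have h4 : v + y - y ⊓ v - y = v - y ⊓ v := by abel
    rw [h4] at key
    simpa using key

end BandProjection

variable {E U : Type*} [AddCommGroup E] [ConditionallyCompleteLattice E]
  [IsOrderedAddMonoid E] [Module ℝ E] [IsOrderedModule ℝ E]
  [AddCommGroup U] [ConditionallyCompleteLattice U] [IsOrderedAddMonoid U]
  [Module ℝ U] [IsOrderedModule ℝ U]
  {C : ConditionalRieszTriple E} {K : UniversalCompletion E U}

lemma rieszHom_inf {F H : Type*} [AddCommGroup F] [Module ℝ F] [Lattice F] [IsOrderedAddMonoid F]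
    [AddCommGroup H] [Module ℝ H] [Lattice H] [IsOrderedAddMonoid H] {f : F →ₗ[ℝ] H}
    (hf : IsRieszHom f) (x y : F) : f (x ⊓ y) = f x ⊓ f y := by
  rw [eq_sub_of_add_eq (inf_add_sup x y), eq_sub_of_add_eq (inf_add_sup (f x) (f y)), map_sub,
    map_add, hf]

/-- Strict positivity of `T` excludes a nonzero direction in which a directed set with order
bounded image under `T` is unbounded. -/
lemma exists_not_isLUB_inf_nsmul {B : Set E} (hne : B.Nonempty) (hd : DirectedOn (· ≤ ·) B)
    (hb : BddAbove ((fun b => K.ι (C.T b)) '' B)) {q : E} (hq : 0 < q) :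
    ∃ n : ℕ, ¬ IsLUB ((fun b => n • q ⊓ b) '' B) (n • q) := by
  by_contra! h
  obtain ⟨w, hw⟩ := hb
  have h1 : ∀ n : ℕ, n • K.ι (C.T q) ≤ w := by
    intro n
    have hdd : DirectedOn (· ≤ ·) ((fun b => n • q ⊓ b) '' B) := by
      rintro _ ⟨a, ha, rfl⟩ _ ⟨b, hb, rfl⟩
      obtain ⟨c, hc, hac, hbc⟩ := hd a ha b hb
      exact ⟨_, ⟨c, hc, rfl⟩, inf_le_inf_left _ hac, inf_le_inf_left _ hbc⟩
    have h5 := isLUB_ι (K := K) (isLUB_image C.T_orderContinuous (hne.image _) hdd (h n))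
    rw [← map_nsmul, ← map_nsmul]
    apply h5.2
    rintro _ ⟨_, ⟨_, ⟨a, ha, rfl⟩, rfl⟩, rfl⟩
    exact (ι_le_iff.2 (T_mono inf_le_right)).trans (hw ⟨a, ha, rfl⟩)
  have h2 : C.T q ≤ 0 := by
    rw [← ι_le_iff (K := K), map_zero]
    exact nonpos_of_forall_nsmul_le h1
  exact hq.ne' (C.T_strict q hq.le (le_antisymm h2 (C.T_nonneg q hq.le)))

/-- A directed set of positive elements of `E` is order bounded in the universal completion as soon
as its image under `T` is. -/
lemma bddAbove_ι_of_bddAbove_T {B : Set E} (hne : B.Nonempty) (hd : DirectedOn (· ≤ ·) B)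
    (h0 : ∀ b ∈ B, 0 ≤ b) (hb : BddAbove ((fun b => K.ι (C.T b)) '' B)) :
    BddAbove (K.ι '' B) := by
  let Good : Set (Set U) := {M | (∀ v ∈ M, 0 ≤ v ∧ ∀ b ∈ B, ((K.ι b - v) ⊔ 0) ⊓ v = 0) ∧
    M.Pairwise (fun u v => u ⊓ v = 0)}
  obtain ⟨M, hM⟩ : ∃ M, Maximal (· ∈ Good) M := by
    apply zorn_subset
    intro c hc hchain
    refine ⟨⋃₀ c, ⟨?_, ?_⟩, fun s hs => Set.subset_sUnion_of_mem hs⟩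
    · rintro v ⟨s, hs, hv⟩
      exact (hc hs).1 v hv
    · exact (Set.pairwise_sUnion hchain.directedOn).2 fun s hs => (hc hs).2
  obtain ⟨u, hu⟩ := K.laterallyComplete (insert 0 M) (Set.insert_nonempty _ _)
    (by rintro v (rfl | hv); exacts [le_rfl, (hM.prop.1 v hv).1])
    (hM.prop.2.insert (fun v hv _ => by
      have := (hM.prop.1 v hv).1
      exact ⟨inf_eq_left.2 this, inf_eq_right.2 this⟩))
  refine ⟨u, ?_⟩
  rintro _ ⟨b, hbB, rfl⟩
  by_contra hbu
  have hdpos : 0 < (K.ι b - u) ⊔ 0 := by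
    refine lt_of_le_of_ne le_sup_right fun h => hbu ?_
    rw [← sub_nonpos, h]
    exact le_sup_left
  obtain ⟨q, hq, hqd⟩ := K.orderDense _ hdpos
  have hMq : ∀ m ∈ M, m ⊓ K.ι q = 0 := by
    intro m hm
    have hmu : m ≤ u := hu.1 (Set.mem_insert_of_mem _ hm)
    refine inf_eq_zero_of_le (hM.prop.1 m hm).1 (ι_nonneg hq.le) (hqd.trans ?_)
      ((inf_comm _ _).trans ((hM.prop.1 m hm).2 b hbB))
    exact sup_le_sup_right (sub_le_sub_left hmu _) 0
  obtain ⟨n, hn⟩ := exists_not_isLUB_inf_nsmul hne hd hb hq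
  obtain ⟨s, hs, hns⟩ : ∃ s ∈ upperBounds ((fun b => n • q ⊓ b) '' B), ¬ n • q ≤ s := by
    by_contra! h
    exact hn ⟨by rintro _ ⟨a, -, rfl⟩; exact inf_le_left, fun s hs => h s hs⟩
  have hnq : 0 ≤ n • q := nsmul_nonneg hq.le n
  have hs0 : 0 ≤ s := (le_inf hnq (h0 b hbB)).trans (hs ⟨b, hbB, rfl⟩)
  set r := n • q - n • q ⊓ s with hr
  have hr0 : 0 < r := by
    rw [hr, sub_pos]
    exact lt_of_le_of_ne inf_le_left fun h => hns (inf_eq_left.1 h)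
  obtain ⟨v, hrv, hvx, hvr, hv⟩ := exists_bandProjection (x := K.ι (n • q)) (r := K.ι r)
    (ι_nonneg hr0.le) (ι_le_iff.2 (sub_le_self _ (le_inf hnq hs0)))
  have hr0' : 0 < K.ι r := lt_of_le_of_ne (ι_nonneg hr0.le) fun h =>
    hr0.ne (K.ι_injective (by rwa [map_zero]))
  have hvpos : 0 < v := hr0'.trans_le hrv
  have hgood : ∀ b ∈ B, ((K.ι b - v) ⊔ 0) ⊓ v = 0 := by
    intro b hb
    apply hv _ le_sup_right
    have h1 : ((K.ι b - K.ι (n • q)) ⊔ 0) ⊓ K.ι r = 0 := by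
      have := inf_sub_sup_zero_eq_zero hr (hs ⟨b, hb, rfl⟩)
      rw [← map_sub, ← map_zero K.ι, ← K.ι_rieszHom, ← rieszHom_inf K.ι_rieszHom, this]
    have h2 := add_inf_eq_zero le_sup_right (sub_nonneg.2 hvx) hr0'.le h1 hvr
    rw [inf_comm] at h2 ⊢
    refine inf_eq_zero_of_le hr0'.le le_sup_right (sup_le ?_ ?_) h2
    · calc K.ι b - v = (K.ι b - K.ι (n • q)) + (K.ι (n • q) - v) := by abel
        _ ≤ _ := add_le_add_left le_sup_left _
    · exact add_nonneg le_sup_right (sub_nonneg.2 hvx)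
  have hdisj : ∀ m ∈ M, m ⊓ v = 0 := by
    intro m hm
    have hm0 := (hM.prop.1 m hm).1
    apply hv m hm0
    refine inf_eq_zero_of_le hm0 hr0'.le (hrv.trans hvx) ?_
    rw [map_nsmul]
    exact inf_nsmul_eq_zero hm0 (ι_nonneg hq.le) (hMq m hm) n
  have hins : insert v M ∈ Good := by
    refine ⟨?_, hM.prop.2.insert fun m hm _ => ⟨?_, hdisj m hm⟩⟩
    · rintro m (rfl | hm)
      exacts [⟨hvpos.le, hgood⟩, hM.prop.1 m hm]
    · rw [inf_comm]; exact hdisj m hm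
  have hvM : v ∈ M := hM.le_of_ge hins (Set.subset_insert v M) (Set.mem_insert v M)
  have := hdisj v hvM
  rw [inf_idem] at this
  exact hvpos.ne' this

end CondExp
namespace CondExp

variable {E U : Type*} [AddCommGroup E] [ConditionallyCompleteLattice E]
  [IsOrderedAddMonoid E] [Module ℝ E] [IsOrderedModule ℝ E]
  [AddCommGroup U] [ConditionallyCompleteLattice U] [IsOrderedAddMonoid U]
  [Module ℝ U] [IsOrderedModule ℝ U]

lemma rieszHom_mono {F H : Type*} [AddCommGroup F] [Module ℝ F] [Lattice F]
    [AddCommGroup H] [Module ℝ H] [Lattice H] {f : F →ₗ[ℝ] H}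
    (hf : IsRieszHom f) {x y : F} (h : x ≤ y) : f x ≤ f y := by
  rw [← sup_eq_right, ← hf, sup_eq_right.2 h]

lemma directedOn_image {F H : Type*} [Preorder F] [Preorder H] {f : F → H} (hf : Monotone f)
    {A : Set F} (hd : DirectedOn (· ≤ ·) A) : DirectedOn (· ≤ ·) (f '' A) := by
  rintro _ ⟨a, ha, rfl⟩ _ ⟨b, hb, rfl⟩
  obtain ⟨c, hc, hac, hbc⟩ := hd a ha b hb
  exact ⟨_, ⟨c, hc, rfl⟩, hf hac, hf hbc⟩

variable {P : CondExpPreservingSystem E} {K : UniversalCompletion E U}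

lemma S_mono : Monotone P.S := fun _ _ h => rieszHom_mono P.S_rieszHom h

lemma S_nonneg {x : E} (h : 0 ≤ x) : 0 ≤ P.S x := by
  simpa using S_mono (P := P) h

lemma ι_S_le {A : Set E} {x w : U} (hne : A.Nonempty) (hd : DirectedOn (· ≤ ·) A)
    (hx : IsLUB (K.ι '' A) x) (hw : w ∈ upperBounds ((fun a => K.ι (P.S a)) '' A))
    {z : E} (hz : K.ι z ≤ x) : K.ι (P.S z) ≤ w := by
  have h1 := isLUB_inf hx (K.ι z)
  rw [inf_eq_left.2 hz] at h1
  have h2 : IsLUB ((fun a => z ⊓ a) '' A) z := by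
    constructor
    · rintro _ ⟨a, -, rfl⟩
      exact inf_le_left
    · intro v hv
      rw [← ι_le_iff (K := K)]
      apply h1.2
      rintro _ ⟨_, ⟨a, ha, rfl⟩, rfl⟩
      show K.ι z ⊓ K.ι a ≤ K.ι v
      rw [← rieszHom_inf K.ι_rieszHom]
      exact ι_le_iff.2 (hv ⟨a, ha, rfl⟩)
  have hdd : DirectedOn (· ≤ ·) ((fun a => z ⊓ a) '' A) :=
    directedOn_image (fun _ _ h => inf_le_inf_left z h) hd
  apply (isLUB_ι (K := K) (isLUB_image P.S_orderContinuous (hne.image _) hdd h2)).2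
  rintro _ ⟨_, ⟨_, ⟨a, ha, rfl⟩, rfl⟩, rfl⟩
  exact (ι_le_iff.2 (S_mono inf_le_right)).trans (hw ⟨a, ha, rfl⟩)

lemma bddAbove_ι_S {A : Set E} (hne : A.Nonempty) (hd : DirectedOn (· ≤ ·) A)
    (h0 : ∀ a ∈ A, 0 ≤ a) (hb : BddAbove ((fun a => K.ι (P.T a)) '' A)) :
    BddAbove ((fun a => K.ι (P.S a)) '' A) := by
  have := bddAbove_ι_of_bddAbove_T (C := P.toConditionalRieszTriple) (K := K) (hne.image P.S)
    (directedOn_image S_mono hd) (by rintro _ ⟨a, ha, rfl⟩; exact S_nonneg (h0 a ha))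
    (by simpa only [Set.image_image, P.T_S] using hb)
  rwa [Set.image_image] at this

variable (P K)

/-- The value `sup {S z : z ∈ E, 0 ≤ z ≤ x}` of the extension of `S` at an element `x` of the
cone `D`. -/
noncomputable def extCone (x : U) : U := sSup ((fun z => K.ι (P.S z)) '' minorants K x)

variable {P K}

lemma isLUB_extCone {x : U} (hx : x ∈ L1Cone P.toConditionalRieszTriple K) {A : Set E}
    (hne : A.Nonempty) (hd : DirectedOn (· ≤ ·) A) (h0 : ∀ a ∈ A, 0 ≤ a)
    (hA : IsLUB (K.ι '' A) x) :
    IsLUB ((fun a => K.ι (P.S a)) '' A) (extCone P K x) := by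
  have hl : IsLUB ((fun z => K.ι (P.S z)) '' minorants K x) (extCone P K x) :=
    isLUB_csSup ⟨_, ⟨0, zero_mem_minorants (L1Cone_nonneg hx), rfl⟩⟩
      (bddAbove_ι_S ⟨0, zero_mem_minorants (L1Cone_nonneg hx)⟩ (directed_minorants x)
        (fun a ha => ha.1) (bddAbove_minorants hx))
  constructor
  · rintro _ ⟨a, ha, rfl⟩
    exact hl.1 ⟨a, ⟨h0 a ha, hA.1 ⟨a, ha, rfl⟩⟩, rfl⟩
  · intro w hw
    apply hl.2
    rintro _ ⟨z, hz, rfl⟩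
    exact ι_S_le hne hd hA hw hz.2

lemma isLUB_extCone_minorants {x : U} (hx : x ∈ L1Cone P.toConditionalRieszTriple K) :
    IsLUB ((fun a => K.ι (P.S a)) '' minorants K x) (extCone P K x) :=
  isLUB_extCone hx ⟨0, zero_mem_minorants (L1Cone_nonneg hx)⟩ (directed_minorants x)
    (fun _ ha => ha.1) (isLUB_minorants (L1Cone_nonneg hx))

lemma extCone_ι {z : E} (hz : 0 ≤ z) : extCone P K (K.ι z) = K.ι (P.S z) := by
  have := isLUB_extCone (P := P) (L1Cone_ι (K := K) hz) (Set.singleton_nonempty z)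
    (directedOn_singleton z) (by simpa using hz) (by simp)
  rw [Set.image_singleton] at this
  exact this.unique isLUB_singleton

lemma extCone_mem {x : U} (hx : x ∈ L1Cone P.toConditionalRieszTriple K) :
    extCone P K x ∈ L1Cone P.toConditionalRieszTriple K := by
  refine ⟨P.S '' minorants K x, ⟨_, ⟨0, zero_mem_minorants (L1Cone_nonneg hx), rfl⟩⟩,
    directedOn_image S_mono (directed_minorants x), ?_, ?_, ?_⟩
  · rintro _ ⟨a, ha, rfl⟩
    exact S_nonneg ha.1
  · rw [Set.image_image]
    exact isLUB_extCone_minorants hx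
  · rw [Set.image_image]
    simp only [P.T_S]
    exact bddAbove_minorants hx

lemma condExpCone_extCone {x : U} (hx : x ∈ L1Cone P.toConditionalRieszTriple K) :
    condExpCone P.toConditionalRieszTriple K (extCone P K x) =
      condExpCone P.toConditionalRieszTriple K x := by
  have hne : (minorants K x).Nonempty := ⟨0, zero_mem_minorants (L1Cone_nonneg hx)⟩
  have h1 := isLUB_condExpCone (extCone_mem hx) (hne.image P.S)
    (directedOn_image S_mono (directed_minorants x))
    (by rintro _ ⟨a, ha, rfl⟩; exact S_nonneg ha.1)
    (by rw [Set.image_image]; exact isLUB_extCone_minorants hx)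
  rw [Set.image_image] at h1
  simp only [P.T_S] at h1
  exact h1.unique (isLUB_condExpCone hx hne (directed_minorants x) (fun a ha => ha.1)
    (isLUB_minorants (L1Cone_nonneg hx)))

lemma extCone_add {x y : U} (hx : x ∈ L1Cone P.toConditionalRieszTriple K)
    (hy : y ∈ L1Cone P.toConditionalRieszTriple K) :
    extCone P K (x + y) = extCone P K x + extCone P K y := by
  have hnx : (minorants K x).Nonempty := ⟨0, zero_mem_minorants (L1Cone_nonneg hx)⟩
  have hny : (minorants K y).Nonempty := ⟨0, zero_mem_minorants (L1Cone_nonneg hy)⟩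
  have h1 := isLUB_extCone (P := P) (L1Cone_add hx hy)
    (A := Set.image2 (· + ·) (minorants K x) (minorants K y)) (hnx.image2 hny)
    (by
      rintro _ ⟨a, ha, b, hb, rfl⟩ _ ⟨a', ha', b', hb', rfl⟩
      obtain ⟨c, hc, h1, h2⟩ := directed_minorants x a ha a' ha'
      obtain ⟨d, hd, h3, h4⟩ := directed_minorants y b hb b' hb'
      exact ⟨c + d, ⟨c, hc, d, hd, rfl⟩, add_le_add h1 h3, add_le_add h2 h4⟩)
    (by rintro _ ⟨a, ha, b, hb, rfl⟩; exact add_nonneg ha.1 hb.1)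
    (by
      rw [Set.image_image2_distrib (g := K.ι) (f := (· + ·)) (fun a b => map_add K.ι a b)]
      exact isLUB_add (isLUB_minorants (L1Cone_nonneg hx)) (isLUB_minorants (L1Cone_nonneg hy)))
  rw [Set.image_image2_distrib (g := fun a => K.ι (P.S a)) (f := (· + ·)) (f' := (· + ·))
    (g₁ := fun a => K.ι (P.S a)) (g₂ := fun a => K.ι (P.S a))
    (fun a b => by simp only [map_add])] at h1
  exact h1.unique (isLUB_add (isLUB_extCone_minorants hx) (isLUB_extCone_minorants hy))

lemma isLUB_smul {F : Type*} [AddCommGroup F] [Lattice F] [IsOrderedAddMonoid F] [Module ℝ F]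
    [IsOrderedModule ℝ F] {A : Set F} {x : F} (h : IsLUB A x) {c : ℝ} (hc : 0 < c) :
    IsLUB ((fun a => c • a) '' A) (c • x) := by
  constructor
  · rintro _ ⟨a, ha, rfl⟩
    exact smul_le_smul_of_nonneg_left (h.1 ha) hc.le
  · intro v hv
    have : x ≤ c⁻¹ • v := by
      apply h.2
      intro a ha
      have := smul_le_smul_of_nonneg_left (hv ⟨a, ha, rfl⟩) (inv_nonneg.2 hc.le)
      rwa [inv_smul_smul₀ hc.ne'] at this
    have := smul_le_smul_of_nonneg_left this hc.le
    rwa [smul_inv_smul₀ hc.ne'] at this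

lemma extCone_smul {x : U} (hx : x ∈ L1Cone P.toConditionalRieszTriple K) {c : ℝ} (hc : 0 < c) :
    extCone P K (c • x) = c • extCone P K x := by
  have hnx : (minorants K x).Nonempty := ⟨0, zero_mem_minorants (L1Cone_nonneg hx)⟩
  have h1 := isLUB_extCone (P := P) (L1Cone_smul hx hc.le)
    (A := (fun a => c • a) '' minorants K x) (hnx.image _)
    (directedOn_image (fun _ _ h => smul_le_smul_of_nonneg_left h hc.le) (directed_minorants x))
    (by rintro _ ⟨a, ha, rfl⟩; exact smul_nonneg hc.le ha.1)
    (by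
      have := isLUB_smul (isLUB_minorants (K := K) (L1Cone_nonneg hx)) hc
      rw [Set.image_image] at this ⊢
      simpa only [map_smul] using this)
  have h2 := isLUB_smul (isLUB_extCone_minorants (P := P) hx) hc
  rw [Set.image_image] at h1 h2
  simp only [map_smul] at h1
  exact h1.unique h2

lemma extCone_inf_eq_zero {x y : U} (hx : x ∈ L1Cone P.toConditionalRieszTriple K)
    (hy : y ∈ L1Cone P.toConditionalRieszTriple K) (h : x ⊓ y = 0) :
    extCone P K x ⊓ extCone P K y = 0 := by
  have h1 : ∀ a ∈ minorants K x, ∀ b ∈ minorants K y, K.ι (P.S a) ⊓ K.ι (P.S b) = 0 := by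
    intro a ha b hb
    have : a ⊓ b = 0 := by
      apply le_antisymm _ (le_inf ha.1 hb.1)
      rw [← ι_le_iff (K := K), rieszHom_inf K.ι_rieszHom, map_zero, ← h]
      exact inf_le_inf ha.2 hb.2
    rw [← rieszHom_inf K.ι_rieszHom, ← rieszHom_inf P.S_rieszHom, this, map_zero, map_zero]
  apply le_antisymm _ (le_inf (L1Cone_nonneg (extCone_mem hx)) (L1Cone_nonneg (extCone_mem hy)))
  apply (isLUB_inf (isLUB_extCone_minorants hy) _).2
  rintro _ ⟨_, ⟨b, hb, rfl⟩, rfl⟩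
  show extCone P K x ⊓ K.ι (P.S b) ≤ 0
  rw [inf_comm]
  apply (isLUB_inf (isLUB_extCone_minorants hx) _).2
  rintro _ ⟨_, ⟨a, ha, rfl⟩, rfl⟩
  show K.ι (P.S b) ⊓ K.ι (P.S a) ≤ 0
  rw [inf_comm, h1 a ha b hb]

lemma extCone_sub_extCone_eq {x y x' y' : U} (hx : x ∈ L1Cone P.toConditionalRieszTriple K)
    (hy : y ∈ L1Cone P.toConditionalRieszTriple K)
    (hx' : x' ∈ L1Cone P.toConditionalRieszTriple K)
    (hy' : y' ∈ L1Cone P.toConditionalRieszTriple K) (h : x - y = x' - y') :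
    extCone P K x - extCone P K y = extCone P K x' - extCone P K y' := by
  rw [sub_eq_sub_iff_add_eq_add] at h ⊢
  rw [← extCone_add hx hy', ← extCone_add hx' hy, h]

lemma L1_posPart {f : U} (hf : f ∈ L1 P.toConditionalRieszTriple K) :
    f⁺ ∈ L1Cone P.toConditionalRieszTriple K := L1Cone_sup_zero hf

lemma L1_negPart {f : U} (hf : f ∈ L1 P.toConditionalRieszTriple K) :
    f⁻ ∈ L1Cone P.toConditionalRieszTriple K :=
  L1Cone_sup_zero ((L1 P.toConditionalRieszTriple K).neg_mem hf)

lemma ext_value_eq {f x y : U} (hf : f ∈ L1 P.toConditionalRieszTriple K)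
    (hx : x ∈ L1Cone P.toConditionalRieszTriple K)
    (hy : y ∈ L1Cone P.toConditionalRieszTriple K) (h : f = x - y) :
    extCone P K f⁺ - extCone P K f⁻ = extCone P K x - extCone P K y :=
  extCone_sub_extCone_eq (L1_posPart hf) (L1_negPart hf) hx hy (by rw [posPart_sub_negPart, h])

variable (P K)

/-- The extension of `S` to the natural domain `L¹(T)` of `T`. -/
noncomputable def ext : L1 P.toConditionalRieszTriple K →ₗ[ℝ] L1 P.toConditionalRieszTriple K where
  toFun f := ⟨extCone P K (f : U)⁺ - extCone P K (f : U)⁻,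
    (L1 _ K).sub_mem (L1_of_cone (extCone_mem (L1_posPart f.2)))
      (L1_of_cone (extCone_mem (L1_negPart f.2)))⟩
  map_add' f g := by
    apply Subtype.ext
    show extCone P K ((f : U) + g)⁺ - extCone P K ((f : U) + g)⁻ =
      (extCone P K (f : U)⁺ - extCone P K (f : U)⁻) + (extCone P K (g : U)⁺ - extCone P K (g : U)⁻)
    rw [ext_value_eq ((L1 _ K).add_mem f.2 g.2) (L1Cone_add (L1_posPart f.2) (L1_posPart g.2))
      (L1Cone_add (L1_negPart f.2) (L1_negPart g.2))
      (by rw [add_sub_add_comm, posPart_sub_negPart, posPart_sub_negPart]),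
      extCone_add (L1_posPart f.2) (L1_posPart g.2), extCone_add (L1_negPart f.2) (L1_negPart g.2),
      add_sub_add_comm]
  map_smul' c f := by
    apply Subtype.ext
    show extCone P K (c • (f : U))⁺ - extCone P K (c • (f : U))⁻ =
      c • (extCone P K (f : U)⁺ - extCone P K (f : U)⁻)
    have hp := L1_posPart f.2
    have hn := L1_negPart f.2
    rcases lt_trichotomy c 0 with hc | rfl | hc
    · have hc' := neg_pos.2 hc
      rw [ext_value_eq ((L1 _ K).smul_mem c f.2) (L1Cone_smul hn hc'.le) (L1Cone_smul hp hc'.le)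
        (by
          conv_lhs => rw [← posPart_sub_negPart (f : U)]
          module), extCone_smul hn hc', extCone_smul hp hc']
      module
    · simp
    · rw [ext_value_eq ((L1 _ K).smul_mem c f.2) (L1Cone_smul hp hc.le) (L1Cone_smul hn hc.le)
        (by rw [← smul_sub, posPart_sub_negPart]), extCone_smul hp hc, extCone_smul hn hc,
        smul_sub]

variable {P K}

lemma coe_ext_eq (f : L1 P.toConditionalRieszTriple K) {x y : U}
    (hx : x ∈ L1Cone P.toConditionalRieszTriple K)
    (hy : y ∈ L1Cone P.toConditionalRieszTriple K) (h : (f : U) = x - y) :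
    (ext P K f : U) = extCone P K x - extCone P K y :=
  ext_value_eq f.2 hx hy h

lemma extCone_zero : extCone P K 0 = 0 := by
  simpa using extCone_ι (P := P) (K := K) le_rfl

lemma zero_mem_L1Cone : (0 : U) ∈ L1Cone P.toConditionalRieszTriple K := by
  simpa using L1Cone_ι (C := P.toConditionalRieszTriple) (K := K) (le_refl (0 : E))

lemma coe_ext_of_cone (f : L1 P.toConditionalRieszTriple K)
    (hf : (f : U) ∈ L1Cone P.toConditionalRieszTriple K) :
    (ext P K f : U) = extCone P K f := by
  rw [coe_ext_eq f hf zero_mem_L1Cone (sub_zero _).symm, extCone_zero, sub_zero]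

lemma posPart_inf_negPart (f : U) : f⁺ ⊓ f⁻ = 0 := by
  have h : f⁺ ⊓ f⁻ = (f + f⁻) ⊓ (0 + f⁻) := by
    rw [zero_add, ← eq_add_of_sub_eq (posPart_sub_negPart f)]
  rw [h, ← inf_add, negPart_def, ← neg_zero, ← neg_inf, neg_zero]
  simp

lemma extCone_posPart_inf (f : L1 P.toConditionalRieszTriple K) :
    extCone P K (f : U)⁺ ⊓ extCone P K (f : U)⁻ = 0 :=
  extCone_inf_eq_zero (L1_posPart f.2) (L1_negPart f.2) (posPart_inf_negPart _)

lemma ext_posPart (f : L1 P.toConditionalRieszTriple K) :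
    (ext P K f : U) ⊔ 0 = extCone P K (f : U)⁺ :=
  sub_sup_zero_of_inf_eq_zero (extCone_posPart_inf f)

lemma ext_negPart (f : L1 P.toConditionalRieszTriple K) :
    (-(ext P K f : U)) ⊔ 0 = extCone P K (f : U)⁻ := by
  have h : -(ext P K f : U) = extCone P K (f : U)⁻ - extCone P K (f : U)⁺ := neg_sub _ _
  rw [h]
  exact sub_sup_zero_of_inf_eq_zero (by rw [inf_comm, extCone_posPart_inf])

lemma ext_rieszHom : IsRieszHom (ext P K) := by
  intro f g
  have h : f ⊔ g = (⟨((f - g : L1 _ K) : U)⁺, L1_of_cone (L1_posPart (f - g).2)⟩ : L1 _ K) + g := by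
    apply Subtype.ext
    show (f : U) ⊔ g = ((f : U) - g) ⊔ 0 + g
    rw [sup_add]; simp
  rw [h, map_add]
  apply Subtype.ext
  show (ext P K _ : U) + ext P K g = (ext P K f : U) ⊔ ext P K g
  rw [coe_ext_of_cone _ (L1_posPart (f - g).2), ← ext_posPart, map_sub]
  show ((ext P K f : U) - ext P K g) ⊔ 0 + ext P K g = _
  rw [sup_add]; simp

lemma ext_toL1 (x : E) :
    ext P K (toL1 P.toConditionalRieszTriple K x) = toL1 P.toConditionalRieszTriple K (P.S x) := by
  apply Subtype.ext
  have h : K.ι x = K.ι (x ⊔ 0) - K.ι (x ⊔ 0 - x) := by rw [map_sub]; abel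
  have h1 : 0 ≤ x ⊔ 0 - x := sub_nonneg.2 le_sup_left
  rw [coe_ext_eq _ (L1Cone_ι le_sup_right) (L1Cone_ι h1) h, extCone_ι le_sup_right,
    extCone_ι h1, ← map_sub, ← map_sub, sub_sub_cancel]
  rfl

lemma condExp_ext (f : L1 P.toConditionalRieszTriple K) :
    condExp P.toConditionalRieszTriple K (ext P K f) = condExp P.toConditionalRieszTriple K f := by
  apply Subtype.ext
  show condExpCone _ K (ext P K f : U)⁺ - condExpCone _ K (ext P K f : U)⁻ =
    condExpCone _ K (f : U)⁺ - condExpCone _ K (f : U)⁻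
  rw [posPart_def, negPart_def (ext P K f : U), ext_posPart, ext_negPart,
    condExpCone_extCone (L1_posPart f.2), condExpCone_extCone (L1_negPart f.2)]

/-- A Dedekind complete Riesz space is an ideal of its universal completion. -/
lemma exists_ι_eq {u : U} {a : E} (hu : 0 ≤ u) (ha : u ≤ K.ι a) : ∃ z, K.ι z = u :=
  ⟨_, (isLUB_ι (isLUB_csSup ⟨0, zero_mem_minorants hu⟩
    ⟨a, fun _ hz => ι_le_iff.1 (hz.2.trans ha)⟩)).unique (isLUB_minorants hu)⟩

lemma isGLB_ι_zero {A : Set E} (h : IsGLB A 0) : IsGLB (K.ι '' A) 0 := by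
  have h1 : IsLUB (-A) 0 := by simpa using h.neg
  have h2 := (isLUB_ι (K := K) h1).neg
  rw [map_zero, neg_zero] at h2
  convert h2 using 1
  ext u
  constructor
  · rintro ⟨a, ha, rfl⟩
    exact ⟨-a, by simpa using ha, map_neg _ _⟩
  · rintro ⟨a, ha, h⟩
    exact ⟨-a, ha, by rw [map_neg, h, neg_neg]⟩

lemma ext_mono {f g : L1 P.toConditionalRieszTriple K} (h : f ≤ g) :
    (ext P K f : U) ≤ ext P K g := rieszHom_mono ext_rieszHom h

lemma ext_orderContinuous : IsOrderContinuous (ext P K) := by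
  intro A hne hd hA
  constructor
  · rintro _ ⟨f, hf, rfl⟩
    have := ext_mono (P := P) (K := K) (hA.1 hf)
    rwa [map_zero] at this
  intro y hy
  obtain ⟨f₀, hf₀⟩ := hne
  have hpos : ∀ f ∈ A, (0 : U) ≤ f := fun f hf => hA.1 hf
  have hcone : (f₀ : U) ∈ L1Cone P.toConditionalRieszTriple K := by
    have := L1_posPart f₀.2
    rwa [posPart_of_nonneg (hpos f₀ hf₀)] at this
  have hx₀ := coe_ext_of_cone f₀ hcone
  suffices h : ∀ a ∈ minorants K (f₀ : U), (y : U) ≤ ext P K f₀ - K.ι (P.S a) by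
    have h1 : (ext P K f₀ : U) ≤ ext P K f₀ - y := by
      conv_lhs => rw [hx₀]
      apply (isLUB_extCone_minorants hcone).2
      rintro _ ⟨a, ha, rfl⟩
      exact le_sub_comm.1 (h a ha)
    show (y : U) ≤ 0
    simpa using h1
  intro a ha
  let Z : Set E := {z | ∃ f ∈ A, K.ι z = (f : U) ⊓ K.ι a}
  have hexists : ∀ f ∈ A, ∃ z, K.ι z = (f : U) ⊓ K.ι a := fun f hf =>
    exists_ι_eq (le_inf (hpos f hf) (ι_nonneg ha.1)) inf_le_right
  have hZ : IsGLB Z 0 := by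
    constructor
    · rintro z ⟨f, hf, hz⟩
      rw [← ι_le_iff (K := K), hz, map_zero]
      exact le_inf (hpos f hf) (ι_nonneg ha.1)
    · intro w hw
      have : toL1 P.toConditionalRieszTriple K w ≤ 0 := by
        apply hA.2
        intro f hf
        obtain ⟨z, hz⟩ := hexists f hf
        show K.ι w ≤ f
        exact (ι_le_iff.2 (hw ⟨f, hf, hz⟩)).trans (hz.le.trans inf_le_left)
      rw [← ι_le_iff (K := K), map_zero]
      exact this
  have hZd : DirectedOn (· ≥ ·) Z := by
    rintro z ⟨f, hf, hz⟩ w ⟨g, hg, hw⟩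
    obtain ⟨k, hk, hkf, hkg⟩ := hd f hf g hg
    obtain ⟨v, hv⟩ := hexists k hk
    refine ⟨v, ⟨k, hk, hv⟩, (ι_le_iff (K := K)).1 ?_, (ι_le_iff (K := K)).1 ?_⟩
    · rw [hv, hz]; exact inf_le_inf_right _ hkf
    · rw [hv, hw]; exact inf_le_inf_right _ hkg
  have hZne : Z.Nonempty := (hexists f₀ hf₀).imp fun z hz => ⟨f₀, hf₀, hz⟩
  have hSZ := isGLB_ι_zero (K := K) (P.S_orderContinuous Z hZne hZd hZ)
  rw [← sub_nonpos]
  apply hSZ.2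
  rintro _ ⟨_, ⟨z, ⟨f, hf, hz⟩, rfl⟩, rfl⟩
  obtain ⟨g, hg, hgf, hg₀⟩ := hd f hf f₀ hf₀
  have hbound : g ≤ f₀ - toL1 P.toConditionalRieszTriple K a +
      toL1 P.toConditionalRieszTriple K z := by
    show (g : U) ≤ f₀ - K.ι a + K.ι z
    rw [hz]
    have h1 : (g : U) ⊓ K.ι a + (g : U) ⊔ K.ι a = g + K.ι a := inf_add_sup _ _
    have h2 : (g : U) ⊔ K.ι a ≤ f₀ := sup_le hg₀ ha.2
    have h3 : (g : U) ⊓ K.ι a ≤ (f : U) ⊓ K.ι a := inf_le_inf_right _ hgf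
    have h4 := (h1.symm.le).trans (add_le_add h3 h2)
    calc (g : U) = g + K.ι a - K.ι a := by abel
      _ ≤ (f : U) ⊓ K.ι a + f₀ - K.ι a := sub_le_sub_right h4 _
      _ = _ := by abel
  have h5 := ext_mono (P := P) (K := K) hbound
  rw [map_add, map_sub, ext_toL1, ext_toL1] at h5
  have h6 : (y : U) ≤ ext P K g := hy ⟨g, hg, rfl⟩
  rw [sub_le_iff_le_add']
  exact h6.trans h5

instance : IsOrderedAddMonoid (L1 P.toConditionalRieszTriple K) where
  add_le_add_left _ _ h c := add_le_add_left (α := U) h (c : U)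

lemma isLUB_toL1_minorants (f : L1 P.toConditionalRieszTriple K) (hf : (0 : U) ≤ f) :
    IsLUB (toL1 P.toConditionalRieszTriple K '' minorants K (f : U)) f := by
  have h := isLUB_minorants (K := K) hf
  constructor
  · rintro _ ⟨a, ha, rfl⟩
    exact ha.2
  · intro g hg
    apply h.2
    rintro _ ⟨a, ha, rfl⟩
    exact hg ⟨a, ha, rfl⟩

/-- Two order continuous maps on `L¹(T)` that agree on `E` are equal. -/
lemma orderContinuous_eq_of_toL1
    {R R' : L1 P.toConditionalRieszTriple K →ₗ[ℝ] L1 P.toConditionalRieszTriple K}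
    (hR : IsOrderContinuous R) (hR' : IsOrderContinuous R')
    (h : ∀ x, R (toL1 _ K x) = R' (toL1 _ K x)) : R = R' := by
  have hpos : ∀ f : L1 P.toConditionalRieszTriple K, (0 : U) ≤ f → R f = R' f := by
    intro f hf
    have hne : (toL1 P.toConditionalRieszTriple K '' minorants K (f : U)).Nonempty :=
      ⟨_, ⟨0, zero_mem_minorants hf, rfl⟩⟩
    have hd : DirectedOn (· ≤ ·) (toL1 P.toConditionalRieszTriple K '' minorants K (f : U)) :=
      directedOn_image (f := toL1 P.toConditionalRieszTriple K)
        (fun _ _ hxy => (ι_le_iff (K := K)).2 hxy) (directed_minorants _)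
    have h1 := isLUB_image hR hne hd (isLUB_toL1_minorants f hf)
    have h2 := isLUB_image hR' hne hd (isLUB_toL1_minorants f hf)
    rw [Set.image_image] at h1 h2
    simp only [h] at h1
    exact h1.unique h2
  ext1 f
  obtain ⟨f, x, hx, y, hy, rfl⟩ := f
  have : (⟨x - y, ⟨x, hx, y, hy, rfl⟩⟩ : L1 P.toConditionalRieszTriple K) =
    ⟨x, L1_of_cone hx⟩ - ⟨y, L1_of_cone hy⟩ := rfl
  rw [this, map_sub, map_sub, hpos _ (L1Cone_nonneg hx), hpos _ (L1Cone_nonneg hy)]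

end CondExp

theorem mainTheorem4 {E U : Type*}
    [AddCommGroup E] [ConditionallyCompleteLattice E] [IsOrderedAddMonoid E]
    [Module ℝ E] [IsOrderedModule ℝ E]
    [AddCommGroup U] [ConditionallyCompleteLattice U] [IsOrderedAddMonoid U]
    [Module ℝ U] [IsOrderedModule ℝ U]
    (P : CondExpPreservingSystem E) (K : UniversalCompletion E U) :
    ∃ S : CondExp.L1 P.toConditionalRieszTriple K →ₗ[ℝ] CondExp.L1 P.toConditionalRieszTriple K,
      (IsRieszHom S ∧ IsOrderContinuous S ∧
        ∀ x : E, S (CondExp.toL1 P.toConditionalRieszTriple K x) =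
          CondExp.toL1 P.toConditionalRieszTriple K (P.S x)) ∧
      (∀ f, CondExp.condExp P.toConditionalRieszTriple K (S f) =
        CondExp.condExp P.toConditionalRieszTriple K f) ∧
      ∀ S' : CondExp.L1 P.toConditionalRieszTriple K →ₗ[ℝ]
          CondExp.L1 P.toConditionalRieszTriple K,
        IsRieszHom S' → IsOrderContinuous S' →
        (∀ x : E, S' (CondExp.toL1 P.toConditionalRieszTriple K x) =
          CondExp.toL1 P.toConditionalRieszTriple K (P.S x)) →
        S' = S :=
  ⟨CondExp.ext P K, ⟨CondExp.ext_rieszHom, CondExp.ext_orderContinuous, CondExp.ext_toL1⟩,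
    CondExp.condExp_ext, fun _ _ hc h => CondExp.orderContinuous_eq_of_toL1 hc
      CondExp.ext_orderContinuous fun x => (h x).trans (CondExp.ext_toL1 x).symm⟩
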